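/- All graphs are finite and simple; digraphs may have loops but no multiple arcs. For $k\ge 0$, a $k$-partitioned graph $(G,A_1,\dots,A_k)$ is a graph $G$ with a partition of $V(G)$ into $k$ disjoint, possibly empty, sets $A_1,\dots,A_k$. For a digraph $H$ with vertex set $\{1,\dots,k\}$ and arc set $A(H)$, the $H$-product of $k$-partitioned graphs with $V(G)\cap V(F)=\emptyset$ is $$(G,A_1,\dots,A_k)\circ_H(F,B_1,\dots,B_k)=(R,A_1\cup B_1,\dots,A_k\cup B_k),$$ where $V(R)=V(G)\cup V(F)$ and $E(R)=E(G)\cup E(F)\cup\{xy: x\in A_i,\ y\in B_j,\ (i,j)\in A(H)\}$. Let $K^k_i$ be the $k$-partitioned graph with a single vertex, lying in the $i$-th part. A graph $G$ is $H$-threshold if, up to isomorphism, it is the underlying graph of a product $K^k_{i_1}\circ_H\cdots\circ_H K^k_{i_n}$ for some $n\ge 0$ and $i_1,\dots,i_n\in\{1,\dots,k\}$ (the empty product being the graph without vertices). The threshold-width $\mathrm{ThrWidth}(G)$ is the minimum number of vertices of a digraph $H$ such that $G$ is $H$-threshold; such an $H$ exists for every $G$. Let $L=\{C_5,\ P_5,\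 \mathrm{House},\ P_3\cup P_2,\ W_4,\ \mathrm{Bull},\ X,\ Y,\ Z\}$, where - $C_n$ and $P_n$ are the cycle and the path on $n$ vertices, and $P_3\cup P_2$ is a disjoint union; - $\mathrm{House}$ is the complement of $P_5$, that is, $C_4$ together with a vertex adjacent to exactly two vertices of it, which are adjacent to each other; - $W_4$ is $C_4$ together with a vertex adjacent to all four of its vertices; - $\mathrm{Bull}$ is a triangle with one pendant vertex attached at each of two of its vertices; - $X$ has vertices $0,\dots,5$ and edges $01,02,12,03,13,34,35$; - $Y$ has vertices $0,\dots,5$ and edges $01,02,12,03,13,34$ (so $5$ is isolated); - $Z$ has vertices $0,\dots,5$ and edges $01,12,23,50,51,52,53,54$. **Theorem.** Let $G$ be a finite simple graph. Then $\mathrm{ThrWidth}(G)\le 2$ if and only if neither $G$ nor its complement $\overline G$ contains a graph from $L$ as an induced subgraph. -/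

import Mathlib

namespace ThresholdWidth

/-- A `k`-partitioned graph `(G, A₁, …, A_k)`: a finite simple graph whose vertex set is
partitioned into `k` (possibly empty) disjoint parts.  The partition is given by the map `part`
sending each vertex to the index of its part, so that `A_i = part ⁻¹' {i}`. -/
structure PartitionedGraph (k : ℕ) where
  /-- the vertex set -/
  V : Type
  /-- graphs are finite -/
  finite : Finite V
  /-- the basic graph -/
  graph : SimpleGraph V
  /-- the index of the part that contains a vertex -/
  part : V → Fin k

/-- The `H`-product `T ∘_H S`: the disjoint union of `T` and `S` (parts united indexwise),
together with all edges `xy` with `x ∈ A_i` in `T`, `y ∈ B_j` in `S`, `(i, j)` an arc of `H`. -/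
def hProd {k : ℕ} (H : Digraph (Fin k)) (T S : PartitionedGraph k) : PartitionedGraph k where
  V := T.V ⊕ S.V
  finite := by
    have := T.finite
    have := S.finite
    infer_instance
  graph :=
    { Adj := fun a b => match a, b with
        | Sum.inl x, Sum.inl x' => T.graph.Adj x x'
        | Sum.inr y, Sum.inr y' => S.graph.Adj y y'
        | Sum.inl x, Sum.inr y => H.Adj (T.part x) (S.part y)
        | Sum.inr y, Sum.inl x => H.Adj (T.part x) (S.part y)
      symm := ⟨by
        rintro (x | y) (x' | y') h
        · exact T.graph.adj_symm h
        · exact h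
        · exact h
        · exact S.graph.adj_symm h⟩
      loopless := ⟨by
        rintro (x | y) h
        · exact T.graph.loopless.irrefl x h
        · exact S.graph.loopless.irrefl y h⟩ }
  part := Sum.elim T.part S.part

/-- `K^k_i`: the `k`-partitioned graph with one vertex, which lies in the `i`-th part. -/
def oneVertex {k : ℕ} (i : Fin k) : PartitionedGraph k where
  V := Unit
  finite := inferInstance
  graph := ⊥
  part := fun _ => i

/-- The `k`-partitioned graph without vertices, the neutral element of every `∘_H`. -/
def noVertex (k : ℕ) : PartitionedGraph k where
  V := Empty
  finite := inferInstance
  graph := ⊥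
  part := Empty.elim

/-- The product `K^k_{i₁} ∘_H ⋯ ∘_H K^k_{i_n}` of one-vertex factors. -/
def wordProd {k : ℕ} (H : Digraph (Fin k)) : List (Fin k) → PartitionedGraph k
  | [] => noVertex k
  | i :: l => hProd H (oneVertex i) (wordProd H l)

/-- `G` is an `H`-threshold graph: it is (isomorphic to) the basic graph of some product
`K^k_{i₁} ∘_H ⋯ ∘_H K^k_{i_n}`. -/
def IsHThreshold {k : ℕ} (H : Digraph (Fin k)) {V : Type*} (G : SimpleGraph V) : Prop :=
  ∃ l : List (Fin k), Nonempty (G ≃g (wordProd H l).graph)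

/-- The threshold-width of `G`: the minimum order of a digraph `H` (loops allowed) such that `G`
is `H`-threshold. The set is non-empty for every finite graph, see
`exists_isHThreshold_thrWidth`. -/
noncomputable def thrWidth {V : Type*} (G : SimpleGraph V) : ℕ :=
  sInf {k : ℕ | ∃ H : Digraph (Fin k), IsHThreshold H G}

theorem wordProd_sorted {n : ℕ} (G : SimpleGraph (Fin n)) (H : Digraph (Fin n))
    (hH : ∀ i j, i < j → (H.Adj i j ↔ G.Adj i j)) (l : List (Fin n)) (hl : l.Pairwise (· < ·)) :
    Function.Injective (wordProd H l).part ∧ (∀ i, (∃ x, (wordProd H l).part x = i) ↔ i ∈ l) ∧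
      ∀ x y, (wordProd H l).graph.Adj x y ↔
        G.Adj ((wordProd H l).part x) ((wordProd H l).part y) := by
  induction l with
  | nil =>
    refine ⟨fun x => Empty.elim x, fun i => ⟨fun ⟨x, _⟩ => Empty.elim x, by simp⟩,
      fun x => Empty.elim x⟩
  | cons i l ih =>
    obtain ⟨hi, hl⟩ := List.pairwise_cons.1 hl
    obtain ⟨h1, h2, h3⟩ := ih hl
    have hlt : ∀ y, i < (wordProd H l).part y := fun y => hi _ ((h2 _).1 ⟨y, rfl⟩)
    refine ⟨?_, ?_, ?_⟩
    · rintro (x | x) (y | y) h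
      · rfl
      · exact absurd h (hlt y).ne
      · exact absurd h (hlt x).ne'
      · exact congrArg Sum.inr (h1 h)
    · intro j
      rw [List.mem_cons, ← h2]
      constructor
      · rintro ⟨x | x, rfl⟩
        · exact Or.inl rfl
        · exact Or.inr ⟨x, rfl⟩
      · rintro (rfl | ⟨x, rfl⟩)
        · exact ⟨Sum.inl (), rfl⟩
        · exact ⟨Sum.inr x, rfl⟩
    · rintro (x | x) (y | y)
      · exact ⟨fun h => h.elim, fun h => (G.loopless.irrefl _ h).elim⟩
      · exact hH _ _ (hlt y)
      · exact (hH _ _ (hlt x)).trans (G.adj_comm _ _)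
      · exact h3 x y

/-- Every finite graph is `H`-threshold for some digraph `H` of order `thrWidth G`, so the minimum
in the definition of `thrWidth` is attained. -/
theorem exists_isHThreshold_thrWidth {V : Type*} [Finite V] (G : SimpleGraph V) :
    ∃ H : Digraph (Fin (thrWidth G)), IsHThreshold H G := by
  refine Nat.sInf_mem (s := {k : ℕ | ∃ H : Digraph (Fin k), IsHThreshold H G}) ?_
  obtain ⟨n, ⟨e⟩⟩ := Finite.exists_equiv_fin V
  let G' : SimpleGraph (Fin n) := G.map e.toEmbedding
  let H : Digraph (Fin n) := ⟨G'.Adj⟩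
  obtain ⟨h1, h2, h3⟩ := wordProd_sorted G' H (fun _ _ _ => Iff.rfl) (List.finRange n)
    (List.pairwise_lt_finRange n)
  refine ⟨n, H, List.finRange n, ⟨(SimpleGraph.Iso.map e G).trans (RelIso.symm ?_)⟩⟩
  exact ⟨Equiv.ofBijective _ ⟨h1, fun i => (h2 i).2 (List.mem_finRange i)⟩,
    fun {x y} => (h3 x y).symm⟩

/-- The cycle on five vertices. -/
def graphC5 : SimpleGraph (Fin 5) := SimpleGraph.cycleGraph 5

/-- The path on five vertices. -/
def graphP5 : SimpleGraph (Fin 5) := SimpleGraph.pathGraph 5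

/-- The house: the 4-cycle `0123` and a vertex `4` adjacent to the two adjacent vertices
`0` and `1`. -/
def graphHouse : SimpleGraph (Fin 5) :=
  SimpleGraph.fromEdgeSet {s(0, 1), s(1, 2), s(2, 3), s(3, 0), s(4, 0), s(4, 1)}

/-- The disjoint union of a path on three vertices and a path on two vertices. -/
def graphP3P2 : SimpleGraph (Fin 5) :=
  SimpleGraph.fromEdgeSet {s(0, 1), s(1, 2), s(3, 4)}

/-- The wheel with four spokes: the 4-cycle `0123` and a vertex `4` adjacent to all of it. -/
def graphW4 : SimpleGraph (Fin 5) :=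
  SimpleGraph.fromEdgeSet
    {s(0, 1), s(1, 2), s(2, 3), s(3, 0), s(4, 0), s(4, 1), s(4, 2), s(4, 3)}

/-- The bull: a triangle `012` with pendant vertices at `0` and at `1`. -/
def graphBull : SimpleGraph (Fin 5) :=
  SimpleGraph.fromEdgeSet {s(0, 1), s(0, 2), s(1, 2), s(0, 3), s(1, 4)}

/-- `X`: the diamond (triangles `012` and `013`), with two pendant vertices `4`, `5` at the
vertex `3` of degree two in the diamond. -/
def graphX : SimpleGraph (Fin 6) :=
  SimpleGraph.fromEdgeSet {s(0, 1), s(0, 2), s(1, 2), s(0, 3), s(1, 3), s(3, 4), s(3, 5)}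

/-- `Y`: the diamond (triangles `012` and `013`), with a pendant vertex `4` at the vertex `3` of
degree two in the diamond, and an isolated vertex `5`. -/
def graphY : SimpleGraph (Fin 6) :=
  SimpleGraph.fromEdgeSet {s(0, 1), s(0, 2), s(1, 2), s(0, 3), s(1, 3), s(3, 4)}

/-- `Z`: the path `0123` on four vertices, an isolated vertex `4`, and a vertex `5` adjacent to
all of these five vertices. -/
def graphZ : SimpleGraph (Fin 6) :=
  SimpleGraph.fromEdgeSet
    {s(0, 1), s(1, 2), s(2, 3), s(5, 0), s(5, 1), s(5, 2), s(5, 3), s(5, 4)}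

/-- The list `L` of nine graphs, each with its number of vertices. -/
def forbiddenList : List (Σ n : ℕ, SimpleGraph (Fin n)) :=
  [⟨5, graphC5⟩, ⟨5, graphP5⟩, ⟨5, graphHouse⟩, ⟨5, graphP3P2⟩, ⟨5, graphW4⟩, ⟨5, graphBull⟩,
    ⟨6, graphX⟩, ⟨6, graphY⟩, ⟨6, graphZ⟩]

end ThresholdWidth

namespace ThresholdWidth

/-! Width at most 2 is a statement about vertex orders. In a product of one-vertex factors,
adjacency is decided by the parts and by which factor comes first. With two parts, each part is a
clique or independent, and between them the order forces nested neighbourhoods. Conversely such a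
chain partition can be turned back into a word; this is `thrWidth_le_two_iff`. A chain partition is
of one of three kinds (`HasChainPartition.cases`): clique plus independent set (no alternating
4-cycle), two independent sets (no C₃, C₅, 2K₂), or two cliques (the complement of the previous
kind). Each of these conditions also suffices. A graph in `forbiddenList` violates all three, and
chain partitions pass to complements and induced subgraphs, so necessity follows. For sufficiency,
an induced C₄ forces `G` to be triangle-free and 2K₂-free, hence of the second kind; dually for 2K₂.
Without C₄, 2K₂ and P₄ there is no alternating 4-cycle. In the remaining case fix an induced P₄:
every other vertex behaves as in the clique or as in the independent set of a split graph, the bull,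
X, Y and Z prevent both types from occurring, and so there is no triangle or no independent triple.
-/

variable {V : Type*} {G : SimpleGraph V}

/-- The vertex set splits into two homogeneous sets (cliques or independent sets) between which
the neighbourhoods are nested. -/
def HasChainPartition (G : SimpleGraph V) : Prop :=
  ∃ A : V → Prop, (∃ p : Prop, ∀ x y, A x → A y → x ≠ y → (G.Adj x y ↔ p)) ∧
    (∃ q : Prop, ∀ x y, ¬A x → ¬A y → x ≠ y → (G.Adj x y ↔ q)) ∧
    ∀ x x' y y', A x → A x' → ¬A y → ¬A y' →
      G.Adj x y → G.Adj x' y' → ¬G.Adj x y' → ¬G.Adj x' y → False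

/-! ### Closure of chain partitions under complements and induced subgraphs -/

theorem HasChainPartition.compl (h : HasChainPartition G) : HasChainPartition Gᶜ := by
  obtain ⟨A, ⟨p, hp⟩, ⟨q, hq⟩, h⟩ := h
  refine ⟨A, ⟨¬p, fun x y hx hy hxy => ?_⟩, ⟨¬q, fun x y hx hy hxy => ?_⟩, ?_⟩
  · simp [SimpleGraph.compl_adj, hxy, hp x y hx hy hxy]
  · simp [SimpleGraph.compl_adj, hxy, hq x y hx hy hxy]
  · intro x x' y y' hx hx' hy hy' h1 h2 h3 h4
    simp only [SimpleGraph.compl_adj] at h1 h2 h3 h4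
    exact h x x' y' y hx hx' hy' hy (by grind) (by grind) h1.2 h2.2

theorem HasChainPartition.of_compl (h : HasChainPartition Gᶜ) : HasChainPartition G := by
  simpa using h.compl

theorem HasChainPartition.of_isIndContained {W : Type*} {F : SimpleGraph W}
    (h : HasChainPartition G) (hF : F.IsIndContained G) : HasChainPartition F := by
  obtain ⟨f⟩ := hF
  obtain ⟨A, ⟨p, hp⟩, ⟨q, hq⟩, h⟩ := h
  refine ⟨fun x => A (f x), ⟨p, fun x y hx hy hxy => ?_⟩, ⟨q, fun x y hx hy hxy => ?_⟩, ?_⟩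
  · rw [← hp _ _ hx hy (f.injective.ne hxy), f.map_adj_iff]
  · rw [← hq _ _ hx hy (f.injective.ne hxy), f.map_adj_iff]
  · intro x x' y y' hx hx' hy hy' h1 h2 h3 h4
    exact h _ _ _ _ hx hx' hy hy' (f.map_adj_iff.2 h1) (f.map_adj_iff.2 h2)
      (mt f.map_adj_iff.1 h3) (mt f.map_adj_iff.1 h4)

/-! ### Words and vertex orders -/

/-- The rank is the position in the word: arcs are read from the earlier factor to the later one. -/
theorem exists_rank_wordProd {k : ℕ} (H : Digraph (Fin k)) (l : List (Fin k)) :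
    ∃ r : (wordProd H l).V → ℕ, Function.Injective r ∧ ∀ x y, r x < r y →
      ((wordProd H l).graph.Adj x y ↔ H.Adj ((wordProd H l).part x) ((wordProd H l).part y)) := by
  induction l with
  | nil => exact ⟨Empty.elim, fun x => Empty.elim x, fun x => Empty.elim x⟩
  | cons i l ih =>
    obtain ⟨r, hr, h⟩ := ih
    refine ⟨Sum.elim (fun _ => 0) (fun x => r x + 1), ?_, ?_⟩
    · rintro (x | x) (y | y) hxy
      · rfl
      · simp at hxy
      · simp at hxy
      · exact congrArg Sum.inr (hr (by simpa using hxy))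
    · rintro (x | x) (y | y) hxy
      · simp at hxy
      · exact Iff.rfl
      · simp at hxy
      · exact h x y (by simpa using hxy)

theorem hasChainPartition_of_rank {k : ℕ} (hk : k ≤ 2) (H : Digraph (Fin k)) (c : V → Fin k)
    (r : V → ℕ) (hr : Function.Injective r)
    (h : ∀ x y, r x < r y → (G.Adj x y ↔ H.Adj (c x) (c y))) : HasChainPartition G := by
  have key : ∀ i, ∀ x y, c x = i → c y = i → x ≠ y → (G.Adj x y ↔ H.Adj i i) := by
    rintro i x y rfl hy hxy
    rcases lt_or_gt_of_ne (hr.ne hxy) with hlt | hlt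
    · rw [h x y hlt, hy]
    · rw [G.adj_comm, h y x hlt, hy]
  have hom : ∀ B : V → Prop, (∀ x y, B x → B y → c x = c y) →
      ∃ p : Prop, ∀ x y, B x → B y → x ≠ y → (G.Adj x y ↔ p) := by
    intro B hB
    by_cases hne : ∃ x, B x
    · obtain ⟨z, hz⟩ := hne
      exact ⟨H.Adj (c z) (c z), fun x y hx hy => key _ x y (hB x z hx hz) (hB y z hy hz)⟩
    · exact ⟨True, fun x y hx => (hne ⟨x, hx⟩).elim⟩
  have h0 : ∀ x y, (c x).val = 0 → (c y).val = 0 → c x = c y := fun x y hx hy =>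
    Fin.ext (hx.trans hy.symm)
  have h1 : ∀ x y, ¬(c x).val = 0 → ¬(c y).val = 0 → c x = c y := fun x y hx hy =>
    Fin.ext (by omega)
  refine ⟨fun x => (c x).val = 0, hom _ h0, hom _ h1, ?_⟩
  intro x x' y y' hx hx' hy hy' e1 e2 e3 e4
  have hxx := h0 x' x hx' hx
  have hyy := h1 y' y hy' hy
  have cross : ∀ u v, c u = c x → c v = c y →
      (r u < r v ∧ (G.Adj u v ↔ H.Adj (c x) (c y))) ∨
        (r v < r u ∧ (G.Adj u v ↔ H.Adj (c y) (c x))) := by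
    intro u v hu hv
    have huv : u ≠ v := by
      rintro rfl
      exact hy (show (c y).val = 0 by rw [← hv, hu]; exact hx)
    rcases lt_or_gt_of_ne (hr.ne huv) with hlt | hlt
    · exact Or.inl ⟨hlt, by rw [h u v hlt, hu, hv]⟩
    · exact Or.inr ⟨hlt, by rw [G.adj_comm, h v u hlt, hu, hv]⟩
  have c1 := cross x y rfl rfl
  have c2 := cross x' y' hxx hyy
  have c3 := cross x y' rfl hyy
  have c4 := cross x' y hxx rfl
  simp only [e1, e2, e3, e4, true_iff, false_iff] at c1 c2 c3 c4
  -- With both arcs or neither, the parts are completely joined or not joined at all. With exactly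
  -- one arc, the two edges and two non-edges order the four vertices cyclically.
  by_cases p1 : H.Adj (c x) (c y) <;> by_cases p2 : H.Adj (c y) (c x) <;>
    simp only [p1, p2, not_true_eq_false, not_false_eq_true, and_true, and_false, or_false,
      false_or] at c1 c2 c3 c4
  all_goals omega

theorem IsHThreshold.hasChainPartition {k : ℕ} (hk : k ≤ 2) {H : Digraph (Fin k)}
    (h : IsHThreshold H G) : HasChainPartition G := by
  obtain ⟨l, ⟨e⟩⟩ := h
  obtain ⟨r, hr, h⟩ := exists_rank_wordProd H l
  refine hasChainPartition_of_rank hk H (fun x => (wordProd H l).part (e x)) (fun x => r (e x))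
    (hr.comp e.injective) fun x y hxy => ?_
  rw [← h _ _ hxy, e.map_adj_iff]

/-- Mapping into the fixed type `V`, with image `l`, lets the induction on `l` avoid induced
subgraphs. -/
theorem exists_embedding_wordProd {k : ℕ} (H : Digraph (Fin k)) (c : V → Fin k) (l : List V)
    (hl : l.Nodup) (h : l.Pairwise fun x y => G.Adj x y ↔ H.Adj (c x) (c y)) :
    ∃ f : (wordProd H (l.map c)).V → V, Function.Injective f ∧ (∀ x, (∃ a, f a = x) ↔ x ∈ l) ∧
      (∀ a, (wordProd H (l.map c)).part a = c (f a)) ∧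
      ∀ a b, (wordProd H (l.map c)).graph.Adj a b ↔ G.Adj (f a) (f b) := by
  induction l with
  | nil => exact ⟨Empty.elim, fun x => Empty.elim x, fun x => ⟨fun ⟨a, _⟩ => Empty.elim a, by simp⟩,
      fun x => Empty.elim x, fun x => Empty.elim x⟩
  | cons v l ih =>
    obtain ⟨hv, hl⟩ := List.nodup_cons.1 hl
    obtain ⟨hvl, h⟩ := List.pairwise_cons.1 h
    obtain ⟨f, f1, f2, f3, f4⟩ := ih hl h
    have hmem : ∀ a, f a ∈ l := fun a => (f2 _).1 ⟨a, rfl⟩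
    have hcross : ∀ b, H.Adj (c v) ((wordProd H (l.map c)).part b) ↔ G.Adj v (f b) := fun b => by
      rw [f3, hvl _ (hmem b)]
    refine ⟨Sum.elim (fun _ => v) f, ?_, ?_, ?_, ?_⟩
    · rintro (a | a) (b | b) hab
      · rfl
      · exact absurd (show v = f b from hab) fun hb => hv (hb ▸ hmem b)
      · exact absurd (show f a = v from hab) fun hb => hv (hb ▸ hmem a)
      · exact congrArg Sum.inr (f1 hab)
    · intro x
      rw [List.mem_cons, ← f2]
      constructor
      · rintro ⟨a | a, rfl⟩
        · exact Or.inl rfl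
        · exact Or.inr ⟨a, rfl⟩
      · rintro (rfl | ⟨a, rfl⟩)
        · exact ⟨Sum.inl (), rfl⟩
        · exact ⟨Sum.inr a, rfl⟩
    · rintro (a | a)
      · rfl
      · exact f3 a
    · rintro (a | a) (b | b)
      · exact ⟨fun h => h.elim, fun h => (G.loopless.irrefl _ h).elim⟩
      · exact hcross b
      · exact (hcross a).trans (G.adj_comm _ _)
      · exact f4 a b

/-- Sort the vertices by key. On ties the hypothesis holds in both orders, so it is irrelevant how
the sort breaks them. -/
theorem isHThreshold_of_key [Finite V] {k : ℕ} (H : Digraph (Fin k)) (c : V → Fin k) (key : V → ℕ)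
    (h : ∀ x y, x ≠ y → key x ≤ key y → (G.Adj x y ↔ H.Adj (c x) (c y))) : IsHThreshold H G := by
  classical
  have := Fintype.ofFinite V
  let l : List V := (Finset.univ : Finset V).toList.mergeSort fun x y => decide (key x ≤ key y)
  have hperm : l.Perm (Finset.univ : Finset V).toList := List.mergeSort_perm _ _
  have hnodup : l.Nodup := hperm.nodup_iff.2 (Finset.nodup_toList _)
  have hsort : l.Pairwise fun x y => key x ≤ key y := by
    have := List.pairwise_mergeSort (le := fun x y : V => decide (key x ≤ key y))
      (fun a b c hab hbc => by simp only [decide_eq_true_eq] at *; omega)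
      (fun a b => by simp only [Bool.or_eq_true, decide_eq_true_eq]; omega)
      (Finset.univ : Finset V).toList
    simpa using this
  obtain ⟨f, f1, f2, -, f4⟩ := exists_embedding_wordProd H c l hnodup
    (hsort.imp₂ (fun x y h1 h2 => h x y h2 h1) hnodup)
  have hsurj : Function.Surjective f := fun x => (f2 x).2 (hperm.mem_iff.2 (by simp))
  exact ⟨l.map c, ⟨RelIso.symm ⟨Equiv.ofBijective f ⟨f1, hsurj⟩, fun {a b} => (f4 a b).symm⟩⟩⟩

theorem HasChainPartition.exists_isHThreshold [Finite V] (h : HasChainPartition G) :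
    ∃ H : Digraph (Fin 2), IsHThreshold H G := by
  classical
  have := Fintype.ofFinite V
  obtain ⟨A, ⟨p, hp⟩, ⟨q, hq⟩, h⟩ := h
  let c : V → Fin 2 := fun x => if A x then 0 else 1
  let H : Digraph (Fin 2) :=
    ⟨fun i j => if i = 0 then (if j = 0 then p else True) else (if j = 0 then False else q)⟩
  -- A vertex of `A` must precede exactly its neighbours outside `A`, so `A` is sorted by the number
  -- of outside non-neighbours. Odd keys in `A` and even keys outside rule out ties; an outside
  -- vertex sits just above its last neighbour, or at 0 if it has none in `A`.
  let f : V → ℕ := fun x => (Finset.univ.filter fun y => ¬A y ∧ ¬G.Adj x y).card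
  let g : V → ℕ := fun y => (Finset.univ.filter fun x => A x ∧ G.Adj x y).sup fun x => 2 * f x + 2
  have hmono : ∀ x x' y, A x → A x' → ¬A y → G.Adj x' y → f x ≤ f x' → G.Adj x y := by
    intro x x' y hx hx' hy hx'y hle
    by_contra hxy
    refine absurd hle (not_le.2 (Finset.card_lt_card ?_))
    rw [Finset.ssubset_iff_of_subset]
    · exact ⟨y, by simp [hy, hxy], by simp [hx'y]⟩
    · intro z hz
      simp only [Finset.mem_filter, Finset.mem_univ, true_and] at hz ⊢
      exact ⟨hz.1, fun hxz => h x x' z y hx hx' hz.1 hy hxz hx'y hxy hz.2⟩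
  have hlt : ∀ x y, A x → ¬A y → G.Adj x y → 2 * f x + 1 < g y := fun x y hx hy hxy =>
    Nat.lt_of_succ_le (Finset.le_sup (f := fun x => 2 * f x + 2) (by simp [hx, hxy]))
  have hgt : ∀ x y, A x → ¬A y → ¬G.Adj x y → g y < 2 * f x + 1 := by
    intro x y hx hy hxy
    refine Nat.lt_succ_of_le (Finset.sup_le fun x' hx' => ?_)
    simp only [Finset.mem_filter, Finset.mem_univ, true_and] at hx'
    by_contra hlt
    exact hxy (hmono x x' y hx hx'.1 hy hx'.2 (by omega))
  refine ⟨H, isHThreshold_of_key H c (fun x => if A x then 2 * f x + 1 else g x) ?_⟩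
  intro x y hxy hle
  by_cases hx : A x <;> by_cases hy : A y <;> simp only [hx, hy, if_true, if_false] at hle
  · simpa [H, c, hx, hy] using hp x y hx hy hxy
  · have : G.Adj x y := by
      by_contra hn
      have := hgt x y hx hy hn
      omega
    simp [H, c, hx, hy, this]
  · have : ¬G.Adj x y := fun hn => by
      have := hlt y x hy hx hn.symm
      omega
    simp [H, c, hx, hy, this]
  · simpa [H, c, hx, hy] using hq x y hx hy hxy

theorem thrWidth_le_two_iff [Finite V] : thrWidth G ≤ 2 ↔ HasChainPartition G := by
  constructor
  · intro h
    obtain ⟨H, hH⟩ := exists_isHThreshold_thrWidth G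
    exact hH.hasChainPartition h
  · exact fun h => Nat.sInf_le h.exists_isHThreshold

/-! ### The three kinds of chain partitions -/

/-- There is no alternating 4-cycle: no two edges `xp`, `yq` with non-edges `py`, `qx`. -/
def NoAlternating (G : SimpleGraph V) : Prop :=
  ∀ x p y q, G.Adj x p → G.Adj y q → Gᶜ.Adj p y → Gᶜ.Adj q x → False

/-- `{C₃, C₅, 2K₂}`-freeness. -/
def IsDifference (G : SimpleGraph V) : Prop :=
  (∀ x y z, G.Adj x y → G.Adj y z → G.Adj z x → False) ∧
  (∀ a b c d e, G.Adj a b → G.Adj b c → G.Adj c d → G.Adj d e → G.Adj e a → Gᶜ.Adj a c →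
    Gᶜ.Adj c e → Gᶜ.Adj e b → Gᶜ.Adj b d → Gᶜ.Adj d a → False) ∧
  ∀ x p y q, G.Adj x p → G.Adj y q → Gᶜ.Adj x y → Gᶜ.Adj p y → Gᶜ.Adj x q → Gᶜ.Adj p q → False

theorem isDifference_of_bipartition (A : V → Prop) (hA : ∀ x y, G.Adj x y → (A x ↔ ¬A y))
    (h : ∀ x x' y y', A x → A x' → ¬A y → ¬A y' →
      G.Adj x y → G.Adj x' y' → Gᶜ.Adj x y' → Gᶜ.Adj x' y → False) : IsDifference G := by
  refine ⟨fun x y z h1 h2 h3 => ?_, fun a b c d e h1 h2 h3 h4 h5 _ _ _ _ _ => ?_,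
    fun x p y q h1 h2 hxy hpy hxq hpq => ?_⟩
  · have := hA _ _ h1
    have := hA _ _ h2
    have := hA _ _ h3
    tauto
  · have := hA _ _ h1
    have := hA _ _ h2
    have := hA _ _ h3
    have := hA _ _ h4
    have := hA _ _ h5
    tauto
  · have e1 := hA _ _ h1
    have e2 := hA _ _ h2
    by_cases hx : A x <;> by_cases hy : A y
    · exact h x y p q hx hy (e1.1 hx) (e2.1 hy) h1 h2 hxq hpy.symm
    · exact h x q p y hx (by tauto) (e1.1 hx) hy h1 h2.symm hxy hpq.symm
    · exact h p y x q (by tauto) hy hx (e2.1 hy) h1.symm h2 hpq hxy.symm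
    · exact h p q x y (by tauto) (by tauto) hx hy h1.symm h2.symm hpy hxq.symm

/-- Edges meet `A` and non-edges meet its complement, so membership in `A` alternates around an
alternating 4-cycle, which then violates nestedness. -/
theorem noAlternating_of_split (A : V → Prop) (h1 : ∀ x y, G.Adj x y → A x ∨ A y)
    (h0 : ∀ x y, Gᶜ.Adj x y → ¬A x ∨ ¬A y)
    (h : ∀ x x' y y', A x → A x' → ¬A y → ¬A y' →
      G.Adj x y → G.Adj x' y' → Gᶜ.Adj x y' → Gᶜ.Adj x' y → False) : NoAlternating G := by
  intro x p y q e1 e2 n1 n2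
  have hxp := h1 _ _ e1
  have hyq := h1 _ _ e2
  have hpy := h0 _ _ n1
  have hqx := h0 _ _ n2
  by_cases hx : A x
  · exact h x y p q hx (by tauto) (by tauto) (by tauto) e1 e2 n2.symm n1.symm
  · exact h p q x y (by tauto) (by tauto) hx (by tauto) e1.symm e2.symm n1 n2

theorem HasChainPartition.cases (h : HasChainPartition G) :
    NoAlternating G ∨ IsDifference G ∨ IsDifference Gᶜ := by
  obtain ⟨A, ⟨p, hp⟩, ⟨q, hq⟩, h⟩ := h
  have h' : ∀ x x' y y', A x → A x' → ¬A y → ¬A y' →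
      G.Adj x y → G.Adj x' y' → Gᶜ.Adj x y' → Gᶜ.Adj x' y → False :=
    fun x x' y y' hx hx' hy hy' h1 h2 h3 h4 => h x x' y y' hx hx' hy hy' h1 h2
      ((SimpleGraph.compl_adj _ _ _).1 h3).2 ((SimpleGraph.compl_adj _ _ _).1 h4).2
  have hp1 : ∀ x y, G.Adj x y → A x → A y → p := fun x y e hx hy => (hp x y hx hy e.ne).1 e
  have hq1 : ∀ x y, G.Adj x y → ¬A x → ¬A y → q := fun x y e hx hy => (hq x y hx hy e.ne).1 e
  have hp0 : ∀ x y, Gᶜ.Adj x y → A x → A y → ¬p := fun x y e hx hy hh =>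
    ((SimpleGraph.compl_adj _ _ _).1 e).2 ((hp x y hx hy e.ne).2 hh)
  have hq0 : ∀ x y, Gᶜ.Adj x y → ¬A x → ¬A y → ¬q := fun x y e hx hy hh =>
    ((SimpleGraph.compl_adj _ _ _).1 e).2 ((hq x y hx hy e.ne).2 hh)
  by_cases hp' : p <;> by_cases hq' : q
  · refine Or.inr (Or.inr (isDifference_of_bipartition A (fun x y e => ?_) ?_))
    · have := hp0 x y e
      have := hq0 x y e
      tauto
    · intro x x' y y' hx hx' hy hy' e1 e2 e3 e4
      rw [compl_compl] at e3 e4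
      exact h' x x' y' y hx hx' hy' hy e3 e4 e1 e2
  · refine Or.inl (noAlternating_of_split A (fun x y e => ?_) (fun x y e => ?_) h')
    · have := hq1 x y e
      tauto
    · have := hp0 x y e
      tauto
  · refine Or.inl (noAlternating_of_split (fun x => ¬A x) (fun x y e => ?_) (fun x y e => ?_) ?_)
    · have := hp1 x y e
      tauto
    · have := hq0 x y e
      tauto
    · intro x x' y y' hx hx' hy hy' e1 e2 e3 e4
      exact h' y y' x x' (not_not.1 hy) (not_not.1 hy') hx hx' e1.symm e2.symm e4.symm e3.symm
  · refine Or.inr (Or.inl (isDifference_of_bipartition A (fun x y e => ?_) h'))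
    have := hp1 x y e
    have := hq1 x y e
    tauto

/-- These are the threshold graphs: sorted by degree, their neighbourhoods are nested up to the two
vertices compared. -/
theorem NoAlternating.hasChainPartition [Finite V] (h : NoAlternating G) :
    HasChainPartition G := by
  classical
  have := Fintype.ofFinite V
  let e := Fintype.equivFin V
  let r : V → ℕ ×ₗ Fin (Fintype.card V) := fun v => toLex (G.degree v, e v)
  have hr : Function.Injective r := fun x y hxy => by
    simpa [r] using congrArg (fun t => (ofLex t).2) hxy
  have hdeg : ∀ x y, r x < r y → G.degree x ≤ G.degree y := fun x y hxy =>
    (Prod.Lex.monotone_fst (α := ℕ) (β := Fin (Fintype.card V)) _ _ hxy.le)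
  have hnest : ∀ x y z, r x < r y → G.Adj x z → z ≠ y → G.Adj y z := by
    intro x y z hxy hxz hzy
    by_contra hyz
    refine absurd (hdeg x y hxy) (not_le.2 ?_)
    rw [← SimpleGraph.card_neighborFinset_eq_degree, ← SimpleGraph.card_neighborFinset_eq_degree]
    by_cases hadj : G.Adj x y
    -- Exchanging `x` for `y` keeps the size of the neighbourhood of `y` and makes it comparable
    -- with that of `x`.
    · have hsub : insert y ((G.neighborFinset y).erase x) ⊂ G.neighborFinset x := by
        rw [Finset.ssubset_iff_of_subset]
        · refine ⟨z, by simpa using hxz, ?_⟩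
          simp [hzy, hyz]
        · intro w hw
          simp only [Finset.mem_insert, Finset.mem_erase, SimpleGraph.mem_neighborFinset] at hw ⊢
          rcases hw with rfl | ⟨hwx, hw⟩
          · exact hadj
          · by_contra hxw
            exact h x z y w hxz hw (by simp [hzy, G.adj_comm, hyz])
              (by simp [hwx, G.adj_comm w, hxw])
      have := Finset.card_lt_card hsub
      rw [Finset.card_insert_of_notMem (by simp), Finset.card_erase_of_mem
        (by simpa using hadj.symm)] at this
      omega
    · refine Finset.card_lt_card ?_
      rw [Finset.ssubset_iff_of_subset]
      · exact ⟨z, by simpa using hxz, by simpa using hyz⟩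
      · intro w hw
        simp only [SimpleGraph.mem_neighborFinset] at hw ⊢
        by_contra hxw
        have hwx : w ≠ x := fun hh => hadj (hh ▸ hw.symm)
        exact h x z y w hxz hw (by simp [hzy, G.adj_comm, hyz])
          (by simp [hwx, G.adj_comm w, hxw])
  -- The later end of every edge lies in `A`, so the complement is independent; `A` is a clique
  -- because a vertex with an earlier neighbour sees everything after it.
  let A : V → Prop := fun v => ∃ w, r w < r v ∧ G.Adj w v
  have hA : ∀ x y, A x → r x < r y → G.Adj x y := by
    rintro x y ⟨w, hwx, hw⟩ hxy
    exact (hnest w y x (hwx.trans hxy) hw (fun hh => by simp [hh] at hxy)).symm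
  refine ⟨A, ⟨True, fun x y hx hy hxy => iff_true_intro ?_⟩,
    ⟨False, fun x y hx hy hxy => iff_false_intro fun hadj => ?_⟩, ?_⟩
  · rcases lt_or_gt_of_ne (hr.ne hxy) with hlt | hlt
    · exact hA x y hx hlt
    · exact (hA y x hy hlt).symm
  · rcases lt_or_gt_of_ne (hr.ne hxy) with hlt | hlt
    · exact hy ⟨x, hlt, hadj⟩
    · exact hx ⟨y, hlt, hadj.symm⟩
  · intro x x' y y' hx hx' hy hy' h1 h2 h3 h4
    refine h x y x' y' h1 h2 ?_ ?_
    · exact (SimpleGraph.compl_adj _ _ _).2 ⟨fun hh => hy (hh ▸ hx'), fun hh => h4 hh.symm⟩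
    · exact (SimpleGraph.compl_adj _ _ _).2 ⟨fun hh => hy' (hh ▸ hx), fun hh => h3 hh.symm⟩

theorem IsDifference.hasChainPartition [Finite V] (h : IsDifference G) :
    HasChainPartition G := by
  classical
  have := Fintype.ofFinite V
  obtain ⟨h3, h5, h2⟩ := h
  rcases isEmpty_or_nonempty V with hV | hV
  · exact ⟨fun _ => True, ⟨True, fun x => isEmptyElim x⟩, ⟨True, fun x => isEmptyElim x⟩,
      fun x => isEmptyElim x⟩
  obtain ⟨u, hu⟩ := Finite.exists_max (fun v => G.degree v)
  have hA : ∀ x y, G.Adj u x → G.Adj u y → ¬G.Adj x y := fun x y hx hy hxy =>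
    h3 u x y hx hxy hy.symm
  -- an edge outside the neighbourhood of `u` has an end that misses a neighbour of `u`
  have hmiss : ∀ x y, ¬G.Adj u x → ¬G.Adj u y → G.Adj x y → ∃ v, G.Adj u v ∧ ¬G.Adj x v := by
    intro x y hx hy hxy
    by_contra! hall
    refine absurd (hu x) (not_le.2 (Finset.card_lt_card ?_))
    rw [Finset.ssubset_iff_of_subset]
    · exact ⟨y, by simpa using hxy, by simpa using hy⟩
    · intro v hv
      simpa using hall v (by simpa using hv)
  -- The neighbours of `u` missed by `x` and by `y` are seen by the other end, as there is no 2K₂;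
  -- this closes an induced pentagon `u w x y v`.
  have hB : ∀ x y, ¬G.Adj u x → ¬G.Adj u y → ¬G.Adj x y := by
    intro x y hx hy hxy
    obtain ⟨v, hv, hxv⟩ := hmiss x y hx hy hxy
    obtain ⟨w, hw, hyw⟩ := hmiss y x hy hx hxy.symm
    have hvw := hA v w hv hw
    have nc : ∀ a b, a ≠ b → ¬G.Adj a b → Gᶜ.Adj a b := fun a b h1 h2 =>
      (SimpleGraph.compl_adj _ _ _).2 ⟨h1, h2⟩
    have ux : u ≠ x := fun hh => hy (hh ▸ hxy)
    have uy : u ≠ y := fun hh => hx (hh ▸ hxy.symm)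
    have vx : v ≠ x := fun hh => hx (hh ▸ hv)
    have vy : v ≠ y := fun hh => hy (hh ▸ hv)
    have wx : w ≠ x := fun hh => hx (hh ▸ hw)
    have wy : w ≠ y := fun hh => hy (hh ▸ hw)
    have hyv : G.Adj y v := by
      by_contra hyv
      exact h2 u v x y hv hxy (nc _ _ ux hx) (nc _ _ vx fun e => hxv e.symm) (nc _ _ uy hy)
        (nc _ _ vy fun e => hyv e.symm)
    have hxw : G.Adj x w := by
      by_contra hxw
      exact h2 u w x y hw hxy (nc _ _ ux hx) (nc _ _ wx fun e => hxw e.symm) (nc _ _ uy hy)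
        (nc _ _ wy fun e => hyw e.symm)
    exact h5 u w x y v hw hxw.symm hxy hyv hv.symm (nc _ _ ux hx) (nc _ _ vx.symm hxv)
      (nc _ _ (fun hh => hxv (hh ▸ hxw)) hvw) (nc _ _ wy fun e => hyw e.symm) (nc _ _ uy.symm fun e => hy e.symm)
  refine ⟨fun v => G.Adj u v, ⟨False, fun x y hx hy _ => iff_false_intro (hA x y hx hy)⟩,
    ⟨False, fun x y hx hy _ => iff_false_intro (hB x y hx hy)⟩, ?_⟩
  intro x x' y y' hx hx' hy hy' e1 e2 e3 e4
  have nc : ∀ a b, a ≠ b → ¬G.Adj a b → Gᶜ.Adj a b := fun a b h1 h2 =>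
    (SimpleGraph.compl_adj _ _ _).2 ⟨h1, h2⟩
  exact h2 x y x' y' e1 e2 (nc _ _ (fun hh => e4 (hh ▸ e1)) (hA x x' hx hx'))
    (nc _ _ (fun hh => hy (hh ▸ hx')) fun e => e4 e.symm)
    (nc _ _ (fun hh => hy' (hh ▸ hx)) e3)
    (nc _ _ (fun hh => e3 (hh ▸ e1)) (hB y y' hy hy'))

/-! ### The forbidden graphs -/

theorem not_isDifference_of_triangle {x y z : V} (h1 : G.Adj x y) (h2 : G.Adj y z)
    (h3 : G.Adj z x) : ¬IsDifference G := fun h => h.1 x y z h1 h2 h3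

theorem not_isDifference_of_two_edges {x p y q : V} (h1 : G.Adj x p) (h2 : G.Adj y q)
    (h3 : Gᶜ.Adj x y) (h4 : Gᶜ.Adj p y) (h5 : Gᶜ.Adj x q) (h6 : Gᶜ.Adj p q) :
    ¬IsDifference G := fun h => h.2.2 x p y q h1 h2 h3 h4 h5 h6

theorem not_isDifference_compl_of_four_cycle {x p y q : V} (h1 : Gᶜ.Adj x p) (h2 : Gᶜ.Adj y q)
    (h3 : G.Adj x y) (h4 : G.Adj p y) (h5 : G.Adj x q) (h6 : G.Adj p q) :
    ¬IsDifference Gᶜ :=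
  not_isDifference_of_two_edges h1 h2 (by simpa using h3) (by simpa using h4) (by simpa using h5)
    (by simpa using h6)

theorem not_hasChainPartition_of_alternating {x p y q : V} (h1 : G.Adj x p) (h2 : G.Adj y q)
    (h3 : Gᶜ.Adj p y) (h4 : Gᶜ.Adj q x) (h : ¬IsDifference G) (h' : ¬IsDifference Gᶜ) :
    ¬HasChainPartition G := fun hc => by
  rcases hc.cases with h0 | h0 | h0
  · exact h0 x p y q h1 h2 h3 h4
  · exact h h0
  · exact h' h0

/-- Each graph gets three witnesses, one against each alternative of `HasChainPartition.cases`. -/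
theorem not_hasChainPartition_of_mem_forbiddenList :
    ∀ F ∈ forbiddenList, ¬HasChainPartition F.2 := by
  simp only [forbiddenList, List.forall_mem_cons, List.not_mem_nil, false_imp_iff, implies_true,
    and_true]
  refine ⟨?_, ?_, ?_, ?_, ?_, ?_, ?_, ?_, ?_⟩
  · refine not_hasChainPartition_of_alternating (x := 0) (p := 1) (y := 3) (q := 2) ?_ ?_ ?_ ?_
      (fun h => h.2.1 0 1 2 3 4 ?_ ?_ ?_ ?_ ?_ ?_ ?_ ?_ ?_ ?_)
      (fun h => h.2.1 0 2 4 1 3 ?_ ?_ ?_ ?_ ?_ ?_ ?_ ?_ ?_ ?_) <;>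
    simp [graphC5, SimpleGraph.cycleGraph_adj] <;> decide
  · refine not_hasChainPartition_of_alternating (x := 0) (p := 1) (y := 3) (q := 2) ?_ ?_ ?_ ?_
      (not_isDifference_of_two_edges (x := 0) (p := 1) (y := 3) (q := 4) ?_ ?_ ?_ ?_ ?_ ?_)
      (not_isDifference_of_triangle (x := 0) (y := 2) (z := 4) ?_ ?_ ?_) <;>
    simp [graphP5, SimpleGraph.pathGraph_adj]
  · refine not_hasChainPartition_of_alternating (x := 0) (p := 1) (y := 3) (q := 2) ?_ ?_ ?_ ?_
      (not_isDifference_of_triangle (x := 0) (y := 1) (z := 4) ?_ ?_ ?_)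
      (not_isDifference_compl_of_four_cycle (x := 0) (p := 2) (y := 1) (q := 3)
        ?_ ?_ ?_ ?_ ?_ ?_) <;>
    simp [graphHouse]
  · refine not_hasChainPartition_of_alternating (x := 0) (p := 1) (y := 3) (q := 4) ?_ ?_ ?_ ?_
      (not_isDifference_of_two_edges (x := 0) (p := 1) (y := 3) (q := 4) ?_ ?_ ?_ ?_ ?_ ?_)
      (not_isDifference_of_triangle (x := 0) (y := 2) (z := 3) ?_ ?_ ?_) <;>
    simp [graphP3P2]
  · refine not_hasChainPartition_of_alternating (x := 0) (p := 1) (y := 3) (q := 2) ?_ ?_ ?_ ?_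
      (not_isDifference_of_triangle (x := 0) (y := 1) (z := 4) ?_ ?_ ?_)
      (not_isDifference_compl_of_four_cycle (x := 0) (p := 2) (y := 1) (q := 3)
        ?_ ?_ ?_ ?_ ?_ ?_) <;>
    simp [graphW4]
  · refine not_hasChainPartition_of_alternating (x := 3) (p := 0) (y := 4) (q := 1) ?_ ?_ ?_ ?_
      (not_isDifference_of_triangle (x := 0) (y := 1) (z := 2) ?_ ?_ ?_)
      (not_isDifference_of_triangle (x := 2) (y := 3) (z := 4) ?_ ?_ ?_) <;>
    simp [graphBull]
  · refine not_hasChainPartition_of_alternating (x := 4) (p := 3) (y := 2) (q := 0) ?_ ?_ ?_ ?_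
      (not_isDifference_of_triangle (x := 0) (y := 1) (z := 2) ?_ ?_ ?_)
      (not_isDifference_of_triangle (x := 2) (y := 4) (z := 5) ?_ ?_ ?_) <;>
    simp [graphX]
  · refine not_hasChainPartition_of_alternating (x := 4) (p := 3) (y := 2) (q := 0) ?_ ?_ ?_ ?_
      (not_isDifference_of_triangle (x := 0) (y := 1) (z := 2) ?_ ?_ ?_)
      (not_isDifference_of_triangle (x := 2) (y := 4) (z := 5) ?_ ?_ ?_) <;>
    simp [graphY]
  · refine not_hasChainPartition_of_alternating (x := 0) (p := 1) (y := 3) (q := 2) ?_ ?_ ?_ ?_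
      (not_isDifference_of_triangle (x := 0) (y := 1) (z := 5) ?_ ?_ ?_)
      (not_isDifference_of_triangle (x := 0) (y := 2) (z := 4) ?_ ?_ ?_) <;>
    simp [graphZ]

/-- Recording non-edges as edges of `Gᶜ` also records distinctness, which yields injectivity. -/
theorem isIndContained_of_forall_lt {n : ℕ} {F : SimpleGraph (Fin n)} (f : Fin n → V)
    (h : ∀ i j, i < j → (F.Adj i j ∧ G.Adj (f i) (f j)) ∨ (¬F.Adj i j ∧ Gᶜ.Adj (f i) (f j))) :
    F.IsIndContained G := by
  have key : ∀ i j, i < j → f i ≠ f j ∧ (G.Adj (f i) (f j) ↔ F.Adj i j) := by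
    intro i j hij
    rcases h i j hij with ⟨h1, h2⟩ | ⟨h1, h2⟩
    · exact ⟨h2.ne, by simp [h1, h2]⟩
    · exact ⟨h2.ne, by simp [h1, ((SimpleGraph.compl_adj _ _ _).1 h2).2]⟩
  refine ⟨⟨⟨f, fun i j hij => ?_⟩, fun {i j} => ?_⟩⟩
  · rcases lt_trichotomy i j with hlt | rfl | hlt
    · exact ((key i j hlt).1 hij).elim
    · rfl
    · exact ((key j i hlt).1 hij.symm).elim
  · rcases lt_trichotomy i j with hlt | rfl | hlt
    · exact (key i j hlt).2
    · simp
    · rw [G.adj_comm, F.adj_comm]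
      exact (key j i hlt).2

/-- Freeness of forbidden graphs, for a graph with edges `E` and non-edges `N`. -/
structure ForbiddenFree (E N : V → V → Prop) : Prop where
  c5 : ∀ a b c d e, E a b → E b c → E c d → E d e → E a e →
    N a c → N a d → N b d → N b e → N c e → False
  house : ∀ a b c d e, E a b → E b c → E c d → E a d → E a e → E b e →
    N a c → N b d → N c e → N d e → False
  p3p2 : ∀ a b c d e, E a b → E b c → E d e →
    N a c → N a d → N a e → N b d → N b e → N c d → N c e → False
  w4 : ∀ a b c d e, E a b → E b c → E c d → E a d → E a e → E b e → E c e → E d e →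
    N a c → N b d → False
  bull : ∀ a b c d e, E a b → E a c → E b c → E a d → E b e →
    N a e → N b d → N c d → N c e → N d e → False
  x : ∀ a b c d e f, E a b → E a c → E b c → E a d → E b d → E d e → E d f →
    N a e → N a f → N b e → N b f → N c d → N c e → N c f → N e f → False
  y : ∀ a b c d e f, E a b → E a c → E b c → E a d → E b d → E d e →
    N a e → N a f → N b e → N b f → N c d → N c e → N c f → N d f → N e f → False
  z : ∀ a b c d e f, E a b → E b c → E c d → E a f → E b f → E c f → E d f → E e f →
    N a c → N a d → N a e → N b d → N b e → N c e → N d e → False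

theorem forbiddenFree_of_forall_not_isIndContained
    (h : ∀ F ∈ forbiddenList, ¬F.2.IsIndContained G) : ForbiddenFree G.Adj Gᶜ.Adj := by
  simp only [forbiddenList, List.forall_mem_cons, List.not_mem_nil, false_imp_iff, implies_true,
    and_true] at h
  -- P₅ is dropped: it is the complement of the house, which is excluded from both graphs.
  obtain ⟨h1, -, h3, h4, h5, h6, h7, h8, h9⟩ := h
  constructor
  · intro a b c d e
    intros
    refine h1 (isIndContained_of_forall_lt ![a, b, c, d, e] ?_)
    have key : graphC5 = SimpleGraph.fromEdgeSet {s(0, 1), s(1, 2), s(2, 3), s(3, 4), s(4, 0)} := by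
      ext i j
      simp only [graphC5, SimpleGraph.cycleGraph_adj, SimpleGraph.fromEdgeSet_adj]
      revert i j
      simp [Fin.forall_fin_succ]
      decide
    simp [-SimpleGraph.compl_adj, Fin.forall_fin_succ, *]
  · intro a b c d e
    intros
    refine h3 (isIndContained_of_forall_lt ![a, b, c, d, e] ?_)
    simp [-SimpleGraph.compl_adj, Fin.forall_fin_succ, graphHouse, *]
  · intro a b c d e
    intros
    refine h4 (isIndContained_of_forall_lt ![a, b, c, d, e] ?_)
    simp [-SimpleGraph.compl_adj, Fin.forall_fin_succ, graphP3P2, *]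
  · intro a b c d e
    intros
    refine h5 (isIndContained_of_forall_lt ![a, b, c, d, e] ?_)
    simp [-SimpleGraph.compl_adj, Fin.forall_fin_succ, graphW4, *]
  · intro a b c d e
    intros
    refine h6 (isIndContained_of_forall_lt ![a, b, c, d, e] ?_)
    simp [-SimpleGraph.compl_adj, Fin.forall_fin_succ, graphBull, *]
  · intro a b c d e f
    intros
    refine h7 (isIndContained_of_forall_lt ![a, b, c, d, e, f] ?_)
    simp [-SimpleGraph.compl_adj, Fin.forall_fin_succ, graphX, *]
  · intro a b c d e f
    intros
    refine h8 (isIndContained_of_forall_lt ![a, b, c, d, e, f] ?_)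
    simp [-SimpleGraph.compl_adj, Fin.forall_fin_succ, graphY, *]
  · intro a b c d e f
    intros
    refine h9 (isIndContained_of_forall_lt ![a, b, c, d, e, f] ?_)
    simp [-SimpleGraph.compl_adj, Fin.forall_fin_succ, graphZ, *]

/-! ### Local structure of graphs without forbidden subgraphs -/

/-- `E` and `N` are the edges and the non-edges of a graph such that neither the graph nor its
complement contains a forbidden graph. -/
structure ForbiddenFreePair (E N : V → V → Prop) : Prop where
  symmE : ∀ {x y}, E x y → E y x
  symmN : ∀ {x y}, N x y → N y x
  excl : ∀ {x y}, E x y → N x y → False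
  neE : ∀ {x y}, E x y → x ≠ y
  neN : ∀ {x y}, N x y → x ≠ y
  total : ∀ {x y}, x ≠ y → E x y ∨ N x y
  free : ForbiddenFree E N
  freeN : ForbiddenFree N E

variable {E N : V → V → Prop}

theorem ForbiddenFreePair.swap (S : ForbiddenFreePair E N) : ForbiddenFreePair N E :=
  ⟨S.symmN, S.symmE, fun h1 h2 => S.excl h2 h1, S.neN, S.neE, fun h => (S.total h).symm, S.freeN,
    S.free⟩

/-- `abcd` is an induced 4-cycle. -/
structure IsFourCycle (E N : V → V → Prop) (a b c d : V) : Prop where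
  ab : E a b
  bc : E b c
  cd : E c d
  da : E d a
  ac : N a c
  bd : N b d

/-- `abcd` is an induced path. -/
structure IsFourPath (E N : V → V → Prop) (a b c d : V) : Prop where
  ab : E a b
  bc : E b c
  cd : E c d
  ac : N a c
  ad : N a d
  bd : N b d

namespace ForbiddenFreePair

variable {a b c d x y z u v w : V}

/-! ### Graphs with an induced 4-cycle -/

theorem rotate (S : ForbiddenFreePair E N) (h : IsFourCycle E N a b c d) :
    IsFourCycle E N b c d a := ⟨h.bc, h.cd, h.da, h.ab, h.bd, S.symmN h.ac⟩

theorem reflect (S : ForbiddenFreePair E N) (h : IsFourCycle E N a b c d) :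
    IsFourCycle E N a d c b :=
  ⟨S.symmE h.da, S.symmE h.cd, S.symmE h.bc, S.symmE h.ab, h.ac, S.symmN h.bd⟩

/-- Four, three or two neighbours on the cycle give W₄, the complement of P₃ ∪ P₂, or the house. -/
theorem not_adj_consecutive (S : ForbiddenFreePair E N) (h : IsFourCycle E N a b c d)
    (ha : E v a) (hb : E v b) : False := by
  have hvc : v ≠ c := fun hh => S.excl (hh ▸ ha) (S.symmN h.ac)
  have hvd : v ≠ d := fun hh => S.excl (hh ▸ hb) (S.symmN h.bd)
  rcases S.total hvc with hc | hc <;> rcases S.total hvd with hd | hd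
  · exact S.free.w4 a b c d v h.ab h.bc h.cd (S.symmE h.da) (S.symmE ha) (S.symmE hb) (S.symmE hc)
      (S.symmE hd) h.ac h.bd
  · exact S.freeN.p3p2 b d v a c h.bd (S.symmN hd) h.ac (S.symmE hb) (S.symmE h.ab) h.bc h.da
      (S.symmE h.cd) ha hc
  · exact S.freeN.p3p2 a c v b d h.ac (S.symmN hc) h.bd (S.symmE ha) h.ab (S.symmE h.da)
      (S.symmE h.bc) h.cd hb hd
  · exact S.free.house a b c d v h.ab h.bc h.cd (S.symmE h.da) (S.symmE ha) (S.symmE hb) h.ac h.bd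
      (S.symmN hc) (S.symmN hd)

/-- Both `x` and `y` miss `a` and `c`. If one of them sees `b` and `d`, it replaces `c` in a 4-cycle
on which the other sees two consecutive vertices. Otherwise `x b a d y` is a C₅, or `adc` and `xy`
form P₃ ∪ P₂. -/
theorem not_adj_of_adj_b (S : ForbiddenFreePair E N) (h : IsFourCycle E N a b c d)
    (hx : E x b) (hy : E y b ∨ E y d) (hxy : E x y) : False := by
  have hxa' : ¬E x a := fun e => S.not_adj_consecutive h e hx
  have hxc' : ¬E x c := fun e => S.not_adj_consecutive (S.rotate h) hx e
  have hya' : ¬E y a := fun e => hy.elim (S.not_adj_consecutive h e)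
    fun e' => S.not_adj_consecutive (S.reflect h) e e'
  have hyc' : ¬E y c := fun e => hy.elim (fun e' => S.not_adj_consecutive (S.rotate h) e' e)
    fun e' => S.not_adj_consecutive (S.rotate (S.rotate h)) e e'
  have hxa := (S.total fun hh : x = a => hya' (S.symmE (hh ▸ hxy))).resolve_left hxa'
  have hxc := (S.total fun hh : x = c => hyc' (S.symmE (hh ▸ hxy))).resolve_left hxc'
  have hya := (S.total fun hh : y = a => hxa' (hh ▸ hxy)).resolve_left hya'
  have hyc := (S.total fun hh : y = c => hxc' (hh ▸ hxy)).resolve_left hyc'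
  have hxd : x ≠ d := fun hh => S.excl (hh ▸ hx) (S.symmN h.bd)
  have both : ∀ {x y}, E x y → E x b → E y b → N x a → E x d → False :=
    fun {x y} hxy hxb hyb hxa hxd => S.not_adj_consecutive (a := x) (b := b) (c := a) (d := d)
      (v := y) ⟨hxb, S.symmE h.ab, S.symmE h.da, S.symmE hxd, hxa, h.bd⟩ (S.symmE hxy) hyb
  rcases S.total hxd with hxd | hxd
  · rcases hy with hy | hy
    · exact both hxy hx hy hxa hxd
    · exact S.not_adj_consecutive (a := x) (b := d) (c := a) (d := b)
        (v := y) ⟨hxd, h.da, h.ab, S.symmE hx, hxa, S.symmN h.bd⟩ (S.symmE hxy) hy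
  · by_cases hyd : E y d
    · by_cases hyb : E y b
      · exact both (S.symmE hxy) hyb hx hya hyd
      · have hyb := (S.total fun hh : y = b => S.excl (hh ▸ hyd) h.bd).resolve_left hyb
        exact S.free.c5 x b a d y hx (S.symmE h.ab) (S.symmE h.da) (S.symmE hyd) hxy hxa hxd h.bd
          (S.symmN hyb) (S.symmN hya)
    · have hyb := hy.resolve_right hyd
      have hyd := (S.total fun hh : y = d => S.excl (hh ▸ hyb) (S.symmN h.bd)).resolve_left hyd
      exact S.free.p3p2 a d c x y (S.symmE h.da) (S.symmE h.cd) hxy h.ac (S.symmN hxa)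
        (S.symmN hya) (S.symmN hxd) (S.symmN hyd) (S.symmN hxc) (S.symmN hyc)

theorem not_adj_of_same_side (S : ForbiddenFreePair E N) (h : IsFourCycle E N a b c d)
    (hx : E x b ∨ E x d) (hy : E y b ∨ E y d) (hxy : E x y) : False :=
  hx.elim (fun e => S.not_adj_of_adj_b h e hy hxy)
    fun e => S.not_adj_of_adj_b (S.reflect h) e hy.symm hxy

/-- `v` lies outside the 4-cycle `abcd` and misses all of it. -/
def IsFar (N : V → V → Prop) (a b c d v : V) : Prop := N v a ∧ N v b ∧ N v c ∧ N v d

theorem isFar (S : ForbiddenFreePair E N) (h : IsFourCycle E N a b c d)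
    (h1 : ¬(E v b ∨ E v d)) (h2 : ¬(E v a ∨ E v c)) : IsFar N a b c d v := by
  rw [not_or] at h1 h2
  exact ⟨(S.total fun hh : v = a => h1.1 (hh ▸ h.ab)).resolve_left h2.1,
    (S.total fun hh : v = b => h2.2 (hh ▸ h.bc)).resolve_left h1.1,
    (S.total fun hh : v = c => h1.2 (hh ▸ h.cd)).resolve_left h2.2,
    (S.total fun hh : v = d => h2.1 (hh ▸ h.da)).resolve_left h1.2⟩

theorem not_adj_of_isFar (S : ForbiddenFreePair E N) (h : IsFourCycle E N a b c d)
    (hx : IsFar N a b c d x) (hy : IsFar N a b c d y) (hxy : E x y) : False :=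
  S.free.p3p2 a b c x y h.ab h.bc hxy h.ac (S.symmN hx.1) (S.symmN hy.1) (S.symmN hx.2.1)
    (S.symmN hy.2.1) (S.symmN hx.2.2.1) (S.symmN hy.2.2.1)

theorem adj_d_of_adj_isFar (S : ForbiddenFreePair E N) (h : IsFourCycle E N a b c d)
    (hx : E x b) (hw : IsFar N a b c d w) (hxw : E x w) : E x d := by
  have hxa := (S.total fun hh : x = a => S.excl (hh ▸ hxw) (S.symmN hw.1)).resolve_left
    fun e => S.not_adj_consecutive h e hx
  have hxc := (S.total fun hh : x = c => S.excl (hh ▸ hxw) (S.symmN hw.2.2.1)).resolve_left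
    fun e => S.not_adj_consecutive (S.rotate h) hx e
  refine (S.total fun hh : x = d => S.excl (hh ▸ hx) (S.symmN h.bd)).resolve_right fun hxd => ?_
  exact S.free.p3p2 a d c x w (S.symmE h.da) (S.symmE h.cd) hxw h.ac (S.symmN hxa) (S.symmN hw.1)
    (S.symmN hxd) (S.symmN hw.2.2.2) (S.symmN hxc) (S.symmN hw.2.2.1)

theorem adj_of_adj_isFar (S : ForbiddenFreePair E N) (h : IsFourCycle E N a b c d)
    (hx : E x b ∨ E x d) (hw : IsFar N a b c d w) (hxw : E x w) : E x b ∧ E x d := by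
  rcases hx with hx | hx
  · exact ⟨hx, S.adj_d_of_adj_isFar h hx hw hxw⟩
  · exact ⟨S.adj_d_of_adj_isFar (S.reflect h) hx ⟨hw.1, hw.2.2.2, hw.2.2.1, hw.2.1⟩ hxw, hx⟩

/-- Being adjacent to a far vertex, `x` sees `b` and `y` sees `a`, so `xyab` is an induced 4-cycle
with `w` joined to its edge `xy`. -/
theorem not_triangle_of_sides (S : ForbiddenFreePair E N) (h : IsFourCycle E N a b c d)
    (hx : E x b ∨ E x d) (hy : E y a ∨ E y c) (hw : IsFar N a b c d w)
    (hxy : E x y) (hxw : E x w) (hyw : E y w) : False := by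
  have hxb := (S.adj_of_adj_isFar h hx hw hxw).1
  have hya := (S.adj_of_adj_isFar (S.rotate h) hy.symm
    ⟨hw.2.1, hw.2.2.1, hw.2.2.2, hw.1⟩ hyw).2
  have hxa := (S.total fun hh : x = a => S.excl (hh ▸ hxw) (S.symmN hw.1)).resolve_left
    fun e => S.not_adj_consecutive h e hxb
  have hyb := (S.total fun hh : y = b => S.excl (hh ▸ hyw) (S.symmN hw.2.1)).resolve_left
    fun e => S.not_adj_consecutive h hya e
  exact S.not_adj_consecutive (a := x) (b := y) (c := a) (d := b)
    ⟨hxy, hya, h.ab, S.symmE hxb, hxa, hyb⟩ (S.symmE hxw) (S.symmE hyw)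

/-- The two sides of the cycle and the far vertices are three independent classes, so a triangle
would meet each of them once. -/
theorem not_triangle_of_fourCycle (S : ForbiddenFreePair E N) (h : IsFourCycle E N a b c d)
    (hxy : E x y) (hyz : E y z) (hzx : E z x) : False := by
  have cases : ∀ v, (E v b ∨ E v d) ∨ (E v a ∨ E v c) ∨ IsFar N a b c d v := fun v => by
    by_cases h1 : E v b ∨ E v d
    · exact Or.inl h1
    · by_cases h2 : E v a ∨ E v c
      · exact Or.inr (Or.inl h2)
      · exact Or.inr (Or.inr (S.isFar h h1 h2))
  have s1 : ∀ {x y}, E x y → (E x b ∨ E x d) → (E y b ∨ E y d) → False :=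
    fun e hx hy => S.not_adj_of_same_side h hx hy e
  have s2 : ∀ {x y}, E x y → (E x a ∨ E x c) → (E y a ∨ E y c) → False :=
    fun e hx hy => S.not_adj_of_same_side (S.rotate h) hx.symm hy.symm e
  have s3 : ∀ {x y}, E x y → IsFar N a b c d x → IsFar N a b c d y → False :=
    fun e hx hy => S.not_adj_of_isFar h hx hy e
  have hyx := S.symmE hxy
  have hzy := S.symmE hyz
  have hxz := S.symmE hzx
  rcases cases x with hx | hx | hx <;> rcases cases y with hy | hy | hy <;>
    rcases cases z with hz | hz | hz <;>
    first
    | exact s1 hxy hx hy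
    | exact s1 hyz hy hz
    | exact s1 hzx hz hx
    | exact s2 hxy hx hy
    | exact s2 hyz hy hz
    | exact s2 hzx hz hx
    | exact s3 hxy hx hy
    | exact s3 hyz hy hz
    | exact s3 hzx hz hx
    | exact S.not_triangle_of_sides h hx hy hz hxy hxz hyz
    | exact S.not_triangle_of_sides h hx hz hy hxz hxy hzy
    | exact S.not_triangle_of_sides h hy hx hz hyx hyz hxz
    | exact S.not_triangle_of_sides h hy hz hx hyz hyx hzx
    | exact S.not_triangle_of_sides h hz hx hy hzx hzy hxy
    | exact S.not_triangle_of_sides h hz hy hx hzy hzx hyx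

theorem not_fourCycle_compl_of_fourCycle (S : ForbiddenFreePair E N)
    (h : IsFourCycle E N a b c d) (h' : IsFourCycle N E x y z w) : False := by
  -- An outside vertex sees an end of each side of the complementary cycle, hence an opposite pair;
  -- that pair is an edge, so a triangle arises.
  have mem : ∀ v, v = x ∨ v = y ∨ v = z ∨ v = w := by
    intro v
    by_contra! hv
    have k1 : ¬(N v x ∧ N v y) := fun k => S.swap.not_adj_consecutive h' k.1 k.2
    have k2 : ¬(N v y ∧ N v z) := fun k => S.swap.not_adj_consecutive (S.swap.rotate h') k.1 k.2
    have k3 : ¬(N v z ∧ N v w) := fun k =>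
      S.swap.not_adj_consecutive (S.swap.rotate (S.swap.rotate h')) k.1 k.2
    have k4 : ¬(N v w ∧ N v x) := fun k =>
      S.swap.not_adj_consecutive (S.swap.rotate (S.swap.rotate (S.swap.rotate h'))) k.1 k.2
    have t1 : ¬(E v x ∧ E v z) := fun k => S.not_triangle_of_fourCycle h k.1 h'.ac (S.symmE k.2)
    have t2 : ¬(E v y ∧ E v w) := fun k => S.not_triangle_of_fourCycle h k.1 h'.bd (S.symmE k.2)
    have := S.total hv.1
    have := S.total hv.2.1
    have := S.total hv.2.2.1
    have := S.total hv.2.2.2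
    tauto
  -- the non-cycle pairs form a perfect matching, so no vertex has two neighbours
  have nbr : ∀ {p q r}, E p q → E p r → q = r := by
    have irr : ∀ {p}, E p p → False := fun e => S.neE e rfl
    have n1 : ∀ {p q}, N p q → E p q → False := fun e1 e2 => S.excl e2 e1
    have n2 : ∀ {p q}, N p q → E q p → False := fun e1 e2 => S.excl e2 (S.symmN e1)
    intro p q r hq hr
    rcases mem p with rfl | rfl | rfl | rfl <;> rcases mem q with rfl | rfl | rfl | rfl <;>
      first
      | exact (irr hq).elim
      | exact (n1 h'.ab hq).elim
      | exact (n1 h'.bc hq).elim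
      | exact (n1 h'.cd hq).elim
      | exact (n1 h'.da hq).elim
      | exact (n2 h'.ab hq).elim
      | exact (n2 h'.bc hq).elim
      | exact (n2 h'.cd hq).elim
      | exact (n2 h'.da hq).elim
      | rcases mem r with rfl | rfl | rfl | rfl <;>
        first
        | rfl
        | exact (irr hr).elim
        | exact (n1 h'.ab hr).elim
        | exact (n1 h'.bc hr).elim
        | exact (n1 h'.cd hr).elim
        | exact (n1 h'.da hr).elim
        | exact (n2 h'.ab hr).elim
        | exact (n2 h'.bc hr).elim
        | exact (n2 h'.cd hr).elim
        | exact (n2 h'.da hr).elim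
  exact S.neN h.ac (nbr (S.symmE h.ab) h.bc)

/-! #### Induced paths -/

theorem reverse (S : ForbiddenFreePair E N) (h : IsFourPath E N a b c d) :
    IsFourPath E N d c b a :=
  ⟨S.symmE h.cd, S.symmE h.bc, S.symmE h.ab, S.symmN h.bd, S.symmN h.ad, S.symmN h.ac⟩

theorem fourPath_swap (S : ForbiddenFreePair E N) (h : IsFourPath E N a b c d) :
    IsFourPath N E b d a c :=
  ⟨h.bd, S.symmN h.ad, h.ac, S.symmE h.ab, h.bc, S.symmE h.cd⟩

/-- `v` belongs to the clique side of the path `abcd`, outside of the path. -/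
def IsCentral (E : V → V → Prop) (a b c d v : V) : Prop := E v b ∧ E v c ∧ (E v a ∨ E v d)

/-- Of the sixteen traces on the path, the ten not listed create C₄, 2K₂, C₅ or a bull. -/
theorem isCentral_or (S : ForbiddenFreePair E N)
    (h4 : ∀ a b c d, ¬IsFourCycle E N a b c d) (h4' : ∀ a b c d, ¬IsFourCycle N E a b c d)
    (h : IsFourPath E N a b c d) (va : v ≠ a) (vb : v ≠ b) (vc : v ≠ c) (vd : v ≠ d) :
    IsCentral E a b c d v ∨ IsCentral N b d a c v := by
  have k1 : ¬(E v a ∧ E v c ∧ N v b) := fun k =>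
    h4 v a b c ⟨k.1, h.ab, h.bc, S.symmE k.2.1, k.2.2, h.ac⟩
  have k2 : ¬(E v b ∧ E v d ∧ N v c) := fun k =>
    h4 v b c d ⟨k.1, h.bc, h.cd, S.symmE k.2.1, k.2.2, h.bd⟩
  have k3 : ¬(E v a ∧ N v c ∧ N v d) := fun k =>
    h4' v c a d ⟨k.2.1, S.symmN h.ac, h.ad, S.symmN k.2.2, k.1, h.cd⟩
  have k4 : ¬(E v d ∧ N v a ∧ N v b) := fun k =>
    h4' v a d b ⟨k.2.1, h.ad, S.symmN h.bd, S.symmN k.2.2, k.1, h.ab⟩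
  have k5 : ¬(E v a ∧ E v d ∧ N v b ∧ N v c) := fun k =>
    S.free.c5 v a b c d k.1 h.ab h.bc h.cd k.2.1 k.2.2.1 k.2.2.2 h.ac h.ad h.bd
  have k6 : ¬(E v b ∧ E v c ∧ N v a ∧ N v d) := fun k =>
    S.free.bull b c v a d h.bc (S.symmE k.1) (S.symmE k.2.1) (S.symmE h.ab) h.cd h.bd
      (S.symmN h.ac) k.2.2.1 k.2.2.2 h.ad
  rcases S.total va with ha | ha <;> rcases S.total vb with hb | hb <;>
    rcases S.total vc with hc | hc <;> rcases S.total vd with hd | hd <;>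
    first
    | exact Or.inl ⟨hb, hc, Or.inl ha⟩
    | exact Or.inl ⟨hb, hc, Or.inr hd⟩
    | exact Or.inr ⟨hd, ha, Or.inl hb⟩
    | exact Or.inr ⟨hd, ha, Or.inr hc⟩
    | exact (k1 ⟨ha, hc, hb⟩).elim
    | exact (k2 ⟨hb, hd, hc⟩).elim
    | exact (k3 ⟨ha, hc, hd⟩).elim
    | exact (k4 ⟨hd, ha, hb⟩).elim
    | exact (k5 ⟨ha, hd, hb, hc⟩).elim
    | exact (k6 ⟨hb, hc, ha, hd⟩).elim

/-- If `v` misses the whole path, Z appears in the graph or its complement; if `v` sees `b`, the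
complement of Y or a bull does. -/
theorem not_central_pair_of_total (S : ForbiddenFreePair E N) (h : IsFourPath E N a b c d)
    (hua : E u a) (hub : E u b) (huc : E u c) (hud : E u d)
    (hva : N v a) (hvd : N v d) (hvb : N v b ∨ E v b) (hvc : N v c) (huv : u ≠ v) : False := by
  obtain ⟨hab, hbc, hcd, hac, had, hbd⟩ := h
  rcases hvb with hvb | hvb <;> rcases S.total huv with huv | huv
  · apply S.free.z a b c d v u <;>
      first | assumption | exact S.symmE (by assumption) | exact S.symmN (by assumption)
  · apply S.freeN.z b d a c u v <;>
      first | assumption | exact S.symmE (by assumption) | exact S.symmN (by assumption)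
  · apply S.freeN.y a v c d b u <;>
      first | assumption | exact S.symmE (by assumption) | exact S.symmN (by assumption)
  · apply S.free.bull b u a v d <;>
      first | assumption | exact S.symmE (by assumption) | exact S.symmN (by assumption)

theorem not_central_pair_of_not_adj (S : ForbiddenFreePair E N) (h : IsFourPath E N a b c d)
    (hua : E u a) (hub : E u b) (huc : E u c) (hud : N u d)
    (hva : N v a) (hvd : N v d) (hv : N v b ∨ N v c) (vb : v ≠ b) (vc : v ≠ c) (huv : u ≠ v) :
    False := by
  obtain ⟨hab, hbc, hcd, hac, had, hbd⟩ := h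
  rcases S.total vb with hvb | hvb <;> rcases S.total vc with hvc | hvc <;>
    rcases S.total huv with huv | huv
  · exact hv.elim (S.excl hvb) (S.excl hvc)
  · exact hv.elim (S.excl hvb) (S.excl hvc)
  · apply S.freeN.x a v c d b u <;>
      first | assumption | exact S.symmE (by assumption) | exact S.symmN (by assumption)
  · apply S.free.bull b c u v d <;>
      first | assumption | exact S.symmE (by assumption) | exact S.symmN (by assumption)
  · apply S.free.bull c u v d a <;>
      first | assumption | exact S.symmE (by assumption) | exact S.symmN (by assumption)
  · apply S.free.x b u a c d v <;>
      first | assumption | exact S.symmE (by assumption) | exact S.symmN (by assumption)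
  · apply S.free.bull c u b d v <;>
      first | assumption | exact S.symmE (by assumption) | exact S.symmN (by assumption)
  · apply S.free.y b u a c d v <;>
      first | assumption | exact S.symmE (by assumption) | exact S.symmN (by assumption)

theorem not_central_pair (S : ForbiddenFreePair E N) (h : IsFourPath E N a b c d)
    (hu : IsCentral E a b c d u) (hv : IsCentral N b d a c v)
    (ua : u ≠ a) (ud : u ≠ d) (vb : v ≠ b) (vc : v ≠ c) : False := by
  obtain ⟨hub, huc, hu⟩ := hu
  obtain ⟨hvd, hva, hv⟩ := hv
  have huv : u ≠ v := by
    rintro rfl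
    exact hu.elim (fun e => S.excl e hva) fun e => S.excl e hvd
  rcases S.total ua with hua | hua
  · rcases S.total ud with hud | hud
    · rcases hv with hv | hv
      · exact S.not_central_pair_of_total (S.reverse h) hud huc hub hua hvd hva (S.total vc).symm hv
          huv
      · exact S.not_central_pair_of_total h hua hub huc hud hva hvd (S.total vb).symm hv huv
    · exact S.not_central_pair_of_not_adj h hua hub huc hud hva hvd hv vb vc huv
  · exact S.not_central_pair_of_not_adj (S.reverse h)
      (hu.resolve_left fun e => S.excl e hua) huc hub hua hvd hva hv.symm vc vb huv

/-- A common neighbour among the ends `a`, `d` closes an induced C₄; otherwise `u` and `v` see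
different ends and a 2K₂ appears. -/
theorem adj_of_isCentral (S : ForbiddenFreePair E N)
    (h4 : ∀ a b c d, ¬IsFourCycle E N a b c d) (h4' : ∀ a b c d, ¬IsFourCycle N E a b c d)
    (h : IsFourPath E N a b c d) (hu : IsCentral E a b c d u) (hv : IsCentral E a b c d v)
    (huv : N u v) : False := by
  obtain ⟨hub, huc, hu⟩ := hu
  obtain ⟨hvb, hvc, hv⟩ := hv
  have ka : ¬(E u a ∧ E v a) := fun k =>
    h4 a u c v ⟨S.symmE k.1, huc, S.symmE hvc, k.2, h.ac, huv⟩
  have kd : ¬(E u d ∧ E v d) := fun k =>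
    h4 b u d v ⟨S.symmE hub, k.1, S.symmE k.2, hvb, h.bd, huv⟩
  have ne : ∀ {w}, E w b → E w c → w ≠ a ∧ w ≠ d := fun e1 e2 =>
    ⟨fun hh => S.excl (hh ▸ e2) h.ac, fun hh => S.excl (hh ▸ e1) (S.symmN h.bd)⟩
  have cross : ∀ {u v}, N u v → E u a → N u d → E v d → N v a → False := fun huv h1 h2 h3 h4 =>
    h4' _ _ _ _ ⟨huv, h4, h.ad, S.symmN h2, h1, h3⟩
  have := S.total (ne hub huc).1
  have := S.total (ne hub huc).2
  have := S.total (ne hvb hvc).1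
  have := S.total (ne hvb hvc).2
  have := @cross u v huv
  have := @cross v u (S.symmN huv)
  tauto

/-- Without vertices on the independent side, there is no independent set of size three. -/
theorem not_coTriangle_of_forall_isCentral (S : ForbiddenFreePair E N)
    (h4 : ∀ a b c d, ¬IsFourCycle E N a b c d) (h4' : ∀ a b c d, ¬IsFourCycle N E a b c d)
    (h : IsFourPath E N a b c d)
    (hall : ∀ v, v ≠ a → v ≠ b → v ≠ c → v ≠ d → IsCentral E a b c d v)
    (hxy : N x y) (hyz : N y z) (hzx : N z x) : False := by
  -- `Q` is a clique, so an independent triple would be `a`, `d` and a member of `Q`; but each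
  -- member sees `a` or `d`.
  let Q : V → Prop := fun v => v = b ∨ v = c ∨ IsCentral E a b c d v
  have cases : ∀ v, v = a ∨ v = d ∨ Q v := fun v => by
    by_contra! hv
    exact hv.2.2 (Or.inr (Or.inr (hall v hv.1 (fun e => hv.2.2 (Or.inl e))
      (fun e => hv.2.2 (Or.inr (Or.inl e))) hv.2.1)))
  have hQ : ∀ {u v}, N u v → Q u → Q v → False := by
    rintro u v huv (rfl | rfl | hu) (rfl | rfl | hv)
    · exact S.neN huv rfl
    · exact S.excl h.bc huv
    · exact S.excl hv.1 (S.symmN huv)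
    · exact S.excl h.bc (S.symmN huv)
    · exact S.neN huv rfl
    · exact S.excl hv.2.1 (S.symmN huv)
    · exact S.excl hu.1 huv
    · exact S.excl hu.2.1 huv
    · exact S.adj_of_isCentral h4 h4' h hu hv huv
  have hQad : ∀ {u}, Q u → N u a → N u d → False := by
    rintro u (rfl | rfl | hu) h1 h2
    · exact S.excl (S.symmE h.ab) h1
    · exact S.excl h.cd h2
    · exact hu.2.2.elim (fun e => S.excl e h1) fun e => S.excl e h2
  have hyx := S.symmN hxy
  have hzy := S.symmN hyz
  have hxz := S.symmN hzx
  rcases cases x with hx | hx | hx <;> rcases cases y with hy | hy | hy <;>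
    rcases cases z with hz | hz | hz <;>
    first
    | exact hQ hxy hx hy
    | exact hQ hyz hy hz
    | exact hQ hzx hz hx
    | exact S.neN hxy (hx.trans hy.symm)
    | exact S.neN hyz (hy.trans hz.symm)
    | exact S.neN hzx (hz.trans hx.symm)
    | exact hQad hx (hy ▸ hxy) (hz ▸ hxz)
    | exact hQad hx (hz ▸ hxz) (hy ▸ hxy)
    | exact hQad hy (hx ▸ hyx) (hz ▸ hyz)
    | exact hQad hy (hz ▸ hyz) (hx ▸ hyx)
    | exact hQad hz (hx ▸ hzx) (hy ▸ hzy)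
    | exact hQad hz (hy ▸ hzy) (hx ▸ hzx)

theorem not_triangle_and_coTriangle (S : ForbiddenFreePair E N)
    (h4 : ∀ a b c d, ¬IsFourCycle E N a b c d) (h4' : ∀ a b c d, ¬IsFourCycle N E a b c d)
    (h : IsFourPath E N a b c d) {x' y' z' : V} (hxy : E x y) (hyz : E y z) (hzx : E z x)
    (hxy' : N x' y') (hyz' : N y' z') (hzx' : N z' x') : False := by
  by_cases hall : ∀ v, v ≠ a → v ≠ b → v ≠ c → v ≠ d → IsCentral E a b c d v
  · exact S.not_coTriangle_of_forall_isCentral h4 h4' h hall hxy' hyz' hzx'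
  by_cases hall' : ∀ v, v ≠ b → v ≠ d → v ≠ a → v ≠ c → IsCentral N b d a c v
  · exact S.swap.not_coTriangle_of_forall_isCentral h4' h4 (S.fourPath_swap h) hall' hxy hyz hzx
  push Not at hall hall'
  obtain ⟨v, va, vb, vc, vd, hv⟩ := hall
  obtain ⟨u, ub, ud, ua, uc, hu⟩ := hall'
  exact S.not_central_pair h ((S.isCentral_or h4 h4' h ua ub uc ud).resolve_right hu)
    ((S.isCentral_or h4 h4' h va vb vc vd).resolve_left hv) ua ud vb vc

end ForbiddenFreePair

/-! ### From forbidden subgraphs to a chain partition -/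

theorem isDifference_of_forbiddenFree (hf : ForbiddenFree G.Adj Gᶜ.Adj)
    (h3 : ∀ x y z, G.Adj x y → G.Adj y z → G.Adj z x → False)
    (h4 : ∀ a b c d, ¬IsFourCycle Gᶜ.Adj G.Adj a b c d) : IsDifference G :=
  ⟨h3, fun a b c d e h1 h2 h3 h4 h5 n1 n2 n3 n4 n5 =>
    hf.c5 a b c d e h1 h2 h3 h4 h5.symm n1 n5.symm n4 n3.symm n2,
    fun x p y q h1 h2 n1 n2 n3 n4 => h4 x y p q ⟨n1, n2.symm, n4, n3.symm, h1, h2⟩⟩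

/-- An alternating 4-cycle leaves two pairs undetermined; two, one or no edges there give C₄, P₄ or
2K₂. -/
theorem noAlternating_of_forall_not (h4 : ∀ a b c d, ¬IsFourCycle G.Adj Gᶜ.Adj a b c d)
    (h4' : ∀ a b c d, ¬IsFourCycle Gᶜ.Adj G.Adj a b c d)
    (hP : ∀ a b c d, ¬IsFourPath G.Adj Gᶜ.Adj a b c d) : NoAlternating G := by
  intro x p y q e1 e2 n1 n2
  have nc : ∀ {a b}, a ≠ b → ¬G.Adj a b → Gᶜ.Adj a b := fun h1 h2 =>
    (SimpleGraph.compl_adj _ _ _).2 ⟨h1, h2⟩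
  have excl : ∀ {a b}, G.Adj a b → Gᶜ.Adj a b → False := fun h1 h2 =>
    ((SimpleGraph.compl_adj _ _ _).1 h2).2 h1
  have hxy : x ≠ y := fun hh => excl (hh ▸ e1).symm n1
  have hpq : p ≠ q := fun hh => excl (hh ▸ e1).symm n2
  by_cases k1 : G.Adj x y <;> by_cases k2 : G.Adj p q
  · exact h4 x p q y ⟨e1, k2, e2.symm, k1.symm, n2.symm, n1⟩
  · exact hP p x y q ⟨e1.symm, k1, e2, n1, nc hpq k2, n2.symm⟩
  · exact hP x p q y ⟨e1, k2, e2.symm, n2.symm, nc hxy k1, n1⟩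
  · exact h4' x y p q ⟨nc hxy k1, n1.symm, nc hpq k2, n2, e1, e2⟩

theorem hasChainPartition_of_forbiddenFree [Finite V] (hf : ForbiddenFree G.Adj Gᶜ.Adj)
    (hf' : ForbiddenFree Gᶜ.Adj G.Adj) : HasChainPartition G := by
  have S : ForbiddenFreePair G.Adj Gᶜ.Adj := by
    refine ⟨fun h => h.symm, fun h => h.symm, fun h1 h2 => ?_, fun h => h.ne, fun h => h.ne,
      fun h => ?_, hf, hf'⟩
    · exact ((SimpleGraph.compl_adj _ _ _).1 h2).2 h1
    · rw [SimpleGraph.compl_adj]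
      tauto
  have hfc : ForbiddenFree Gᶜ.Adj Gᶜᶜ.Adj := by rwa [compl_compl]
  by_cases h4 : ∃ a b c d, IsFourCycle G.Adj Gᶜ.Adj a b c d
  · obtain ⟨a, b, c, d, h⟩ := h4
    exact (isDifference_of_forbiddenFree hf (fun _ _ _ => S.not_triangle_of_fourCycle h)
      fun _ _ _ _ => S.not_fourCycle_compl_of_fourCycle h).hasChainPartition
  by_cases h4' : ∃ a b c d, IsFourCycle Gᶜ.Adj G.Adj a b c d
  · obtain ⟨a, b, c, d, h⟩ := h4'
    refine (isDifference_of_forbiddenFree hfc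
      (fun _ _ _ => S.swap.not_triangle_of_fourCycle h) ?_).hasChainPartition.of_compl
    rw [compl_compl]
    exact fun _ _ _ _ => S.swap.not_fourCycle_compl_of_fourCycle h
  push Not at h4 h4'
  by_cases hP : ∃ a b c d, IsFourPath G.Adj Gᶜ.Adj a b c d
  swap
  · push Not at hP
    exact (noAlternating_of_forall_not h4 h4' hP).hasChainPartition
  obtain ⟨a, b, c, d, h⟩ := hP
  by_cases h3 : ∃ x y z, G.Adj x y ∧ G.Adj y z ∧ G.Adj z x
  · obtain ⟨x, y, z, hxy, hyz, hzx⟩ := h3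
    refine (isDifference_of_forbiddenFree hfc (fun _ _ _ =>
      S.not_triangle_and_coTriangle h4 h4' h hxy hyz hzx) ?_).hasChainPartition.of_compl
    rwa [compl_compl]
  · exact (isDifference_of_forbiddenFree hf (fun x y z h1 h2 h3' => h3 ⟨x, y, z, h1, h2, h3'⟩)
      h4').hasChainPartition

end ThresholdWidth

theorem mainTheorem2 {V : Type*} [Finite V] (G : SimpleGraph V) :
    ThresholdWidth.thrWidth G ≤ 2 ↔
      ∀ F ∈ ThresholdWidth.forbiddenList,
        ¬ SimpleGraph.IsIndContained F.2 G ∧ ¬ SimpleGraph.IsIndContained F.2 Gᶜ := by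
  rw [ThresholdWidth.thrWidth_le_two_iff]
  constructor
  · intro h F hF
    have hn := ThresholdWidth.not_hasChainPartition_of_mem_forbiddenList F hF
    exact ⟨fun hc => hn (h.of_isIndContained hc), fun hc => hn (h.compl.of_isIndContained hc)⟩
  · intro h
    refine ThresholdWidth.hasChainPartition_of_forbiddenFree
      (ThresholdWidth.forbiddenFree_of_forall_not_isIndContained fun F hF => (h F hF).1) ?_
    simpa using ThresholdWidth.forbiddenFree_of_forall_not_isIndContained fun F hF => (h F hF).2
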